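/- An infinite time Turing machine has a one-way infinite input tape for each of its $k$ arguments, a scratch tape and an output tape, all read and written by one head according to a program with finitely many states, among them distinct start, limit and halt states. It begins in the start state, with the head on the first cell, the inputs on the input tapes and $0$s elsewhere. Successor stages are ordinary Turing machine steps: write $0$ or $1$ on each tape, move left or right (a head told to move left from the first cell stays there), change state. At a limit ordinal stage the head is on the first cell, the machine is in the limit state, and each cell contains the $\limsup$ of its earlier values. If the machine reaches the halt state, the computation stops and the content of the output tape is the output. Let $\mathbb{R}=2^\omega$, with $0=\langle 0,0,0,\dots\rangle$ and $1=\langle 1,0,0,\dots\rangle$. A partial function $f:\mathbb{R}^k\to\mathbb{R}$ is infinite time computable if some program halts exactly on the inputs in its domain and then outputs its value; a set $A\subseteq\mathbb{R}^k$ is decidable if its characteristic function is infinite time computable, and semi-decidable if the partial function with domain $A$ and constant value $1$ is infinite time computable. A subset of $\mathbb{R}^m$ is (lightface) $\Sigma^1_2$ if it has the form $\{x : \exists y\in\mathbb{R}\ \forall z\in\mathbb{R}\ \varphi(x,y,z)\}$ and $\Pi^1_2$ if it has the form $\{x : \forall y\in\mathbb{R}\ \exists z\in\mathbb{R}\ \varphi(x,y,z)\}$,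 with $\varphi$ an arithmetical formula without further real parameters, and it is $\Delta^1_2$ if it is both. **Theorem.** For every natural number $k$, the graph $\{(x,y)\in\mathbb{R}^{k}\times\mathbb{R} : f(x)=y\}$ of every infinite time computable partial function $f:\mathbb{R}^k\to\mathbb{R}$ is $\Delta^1_2$. Hence every decidable set $A\subseteq\mathbb{R}^k$ and, indeed, every semi-decidable set $A\subseteq\mathbb{R}^k$, is $\Delta^1_2$. -/

import Mathlib

namespace ITTM

/-- The reals of infinite time computability are the points of Cantor space: infinite binary
strings, with `false` for the digit 0 and `true` for the digit 1. -/
abbrev Cantor : Type := ℕ → Bool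

/-- The real 0, that is the string 0,0,0,... -/
def zeroReal : Cantor := fun _ => false

/-- The real 1, that is the string 1,0,0,... -/
def oneReal : Cantor := fun n => decide (n = 0)

/-! ### Infinite time Turing machines -/

/-- The tapes of a machine for functions of `k` arguments: an input tape for every argument
(one input tape when `k = 1`), a scratch tape and an output tape. -/
inductive Tape (k : ℕ) : Type
  | input (i : Fin k)
  | scratch
  | output

/-- The states: the three special ones, which are distinct, and finitely many others. -/
inductive State (n : ℕ) : Type
  | start
  | limit
  | halt
  | aux (i : Fin n)

/-- The two directions in which the head can move. -/
inductive Dir : Type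
  | left
  | right

/-- A program: a finite number of states and a finite transition table, which sends the current
state and the bits under the head (one on each tape) to the bits to be written, the direction of
the move and the new state. The entries for the halt state are never used. -/
structure Program (k : ℕ) : Type where
  numAux : ℕ
  table : State numAux → (Tape k → Bool) → (Tape k → Bool) × Dir × State numAux

/-- A configuration: the state, the position of the head (which is the same on all tapes) and the
contents of the tapes. -/
structure Config (k n : ℕ) : Type where
  state : State n
  head : ℕ
  cells : Tape k → Cantor

namespace Program

variable {k : ℕ} (p : Program k)

/-- The initial configuration: start state, head on the first cell, the inputs on the input tapes
and zeros elsewhere. -/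
def init (x : Fin k → Cantor) : Config k p.numAux where
  state := State.start
  head := 0
  cells
    | Tape.input i => x i
    | Tape.scratch => fun _ => false
    | Tape.output => fun _ => false

/-- The position of the head after a move. A head that is told to move left from the first cell
stays there. -/
def moveHead : Dir → ℕ → ℕ
  | Dir.left, i => i - 1
  | Dir.right, i => i + 1

/-- One step of the computation. -/
def step (c : Config k p.numAux) : Config k p.numAux :=
  let a := p.table c.state (fun t => c.cells t c.head)
  { state := a.2.2
    head := moveHead a.2.1 c.head
    cells := fun t => Function.update (c.cells t) c.head (a.1 t) }

open Classical in
/-- The configuration at a limit stage `o`, from those at the earlier stages: limit state, head on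
the first cell, and each cell has the value 0 if its values before `o` were eventually 0, and
otherwise (if they were eventually 1 or did not converge) the value 1. -/
noncomputable def limitConfig (o : Ordinal.{0}) (c : ∀ b, b < o → Config k p.numAux) :
    Config k p.numAux where
  state := State.limit
  head := 0
  cells t i :=
    if ∃ b < o, ∀ d, b ≤ d → ∀ hd : d < o, (c d hd).cells t i = false then false else true

/-- The configuration of the machine at stage `a` on input `x`. Only the stages up to the first
one in the halt state belong to the computation. -/
noncomputable def run (x : Fin k → Cantor) (a : Ordinal.{0}) : Config k p.numAux :=
  Ordinal.limitRecOn a (p.init x) (fun _ c => p.step c) (fun o _ c => p.limitConfig o c)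

/-- The set of stages in the halt state. -/
def haltStages (x : Fin k → Cantor) : Set Ordinal.{0} :=
  {a | (p.run x a).state = State.halt}

/-- The partial function computed by `p`: it is defined on the inputs for which the machine halts,
and its value is what the output tape shows at the first stage in the halt state. -/
noncomputable def eval : (Fin k → Cantor) →. Cantor := fun x =>
  { Dom := (p.haltStages x).Nonempty
    get := fun _ => (p.run x (sInf (p.haltStages x))).cells Tape.output }

end Program

/-- A partial function of `k` reals is infinite time computable if some program computes it. -/
def Computable {k : ℕ} (f : (Fin k → Cantor) →. Cantor) : Prop :=
  ∃ p : Program k, p.eval = f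

open Classical in
/-- The set `A` is infinite time decidable if its characteristic function is computable. -/
def Decidable {k : ℕ} (A : Set (Fin k → Cantor)) : Prop :=
  Computable (k := k) (fun x => Part.some (if x ∈ A then oneReal else zeroReal))

/-- The set `A` is infinite time semi-decidable if the partial function with domain `A` and
constant value 1 is computable. -/
def SemiDecidable {k : ℕ} (A : Set (Fin k → Cantor)) : Prop :=
  Computable (k := k) (fun x => { Dom := x ∈ A, get := fun _ => oneReal })

/-- The graph of a partial function of `k` reals, as a set of `(k + 1)`-tuples
`(x_0, ..., x_{k-1}, y)`. -/
def graph {k : ℕ} (f : (Fin k → Cantor) →. Cantor) : Set (Fin (k + 1) → Cantor) :=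
  {v | v (Fin.last k) ∈ f (Fin.init v)}

/-! ### The lightface classes of the second level of the analytical hierarchy -/

/-- The function symbols of arithmetic. -/
inductive ArithFunc : ℕ → Type
  | zero : ArithFunc 0
  | one : ArithFunc 0
  | add : ArithFunc 2
  | mul : ArithFunc 2

/-- The relation symbols: the order, and a unary predicate for every real parameter. -/
inductive ArithRel (ι : Type) : ℕ → Type
  | lt : ArithRel ι 2
  | mem (i : ι) : ArithRel ι 1

/-- The language of first-order arithmetic with set parameters indexed by `ι`. Its formulas are
the arithmetical formulas of second-order arithmetic (number quantifiers only) in the free set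
variables `ι`. -/
def arithLang (ι : Type) : FirstOrder.Language.{0, 0} := ⟨ArithFunc, ArithRel ι⟩

/-- The standard model, in which the parameter `i` is interpreted by the real `X i`, viewed as a
set of natural numbers. -/
@[reducible] def arithStructure {ι : Type} (X : ι → Cantor) : (arithLang ι).Structure ℕ where
  funMap {_} f v :=
    match f, v with
    | ArithFunc.zero, _ => 0
    | ArithFunc.one, _ => 1
    | ArithFunc.add, v => v 0 + v 1
    | ArithFunc.mul, v => v 0 * v 1
  RelMap {_} r v :=
    match r, v with
    | ArithRel.lt, v => v 0 < v 1
    | ArithRel.mem i, v => X i (v 0) = true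

/-- The arithmetical sentence `φ` with set parameters is true of the reals `X`. -/
def ArithTrue {ι : Type} (φ : (arithLang ι).Sentence) (X : ι → Cantor) : Prop :=
  letI := arithStructure X
  ℕ ⊨ φ

/-- `A` is (lightface) `Σ¹₂`: defined by `∃ y ∀ z φ(x, y, z)` with `φ` arithmetical and without
real parameters. -/
def IsSigma12 {m : ℕ} (A : Set (Fin m → Cantor)) : Prop :=
  ∃ φ : (arithLang (Fin m ⊕ Fin 2)).Sentence,
    ∀ x, x ∈ A ↔ ∃ y : Cantor, ∀ z : Cantor, ArithTrue φ (Sum.elim x ![y, z])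

/-- `A` is (lightface) `Π¹₂`: defined by `∀ y ∃ z φ(x, y, z)` with `φ` arithmetical and without
real parameters. -/
def IsPi12 {m : ℕ} (A : Set (Fin m → Cantor)) : Prop :=
  ∃ φ : (arithLang (Fin m ⊕ Fin 2)).Sentence,
    ∀ x, x ∈ A ↔ ∀ y : Cantor, ∃ z : Cantor, ArithTrue φ (Sum.elim x ![y, z])

/-- `A` is (lightface) `Δ¹₂`: both `Σ¹₂` and `Π¹₂`. -/
def IsDelta12 {m : ℕ} (A : Set (Fin m → Cantor)) : Prop :=
  IsSigma12 A ∧ IsPi12 A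

end ITTM

/-!
A computation is coded by a real `y`: a binary relation on the numbers, which serve as names of
stages, together with the state, the position of the head and the contents of the cells at each
named stage. That `y` follows the rules of the machine on a given input is an arithmetical
condition (`CoherentAt`), and if the relation is a well-order, then it forces `y` to be an initial
part of the true computation (`forall_coherentAt_iff`). Well-foundedness is a single real
quantifier over an arithmetical condition: every set of numbers `z` satisfies `HasFirst y z`.

A code can only describe a countable part of the computation, but this is enough. In a computation
of length `ω₁`, each cell whose content at stage `ω₁` is 0 has been 0 from some countable stage on.
Beyond those stages there are cofinally many countable limit stages at which the configuration is
the same as at stage `ω₁` (`exists_run_eq_run_omega_one`). Two of them form a loop (`IsLoop`), and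
a machine that has gone once through a loop without halting repeats it forever
(`IsLoop.haltStages_eq_empty`). Hence every input has a coded computation containing a loop
(`exists_isPseudoRun`), and any such code `y` shows whether the machine halts and with which
output (`IsPseudoRun.haltsWith_iff`). Here the run is continued past the halt state by the
transition table, so that there is a loop in every case.

So "the machine halts with output `w`" can be said in two ways: some code of a computation with a
loop shows it, or all such codes show it. With "being such a code" of the form "for all `z`,
arithmetical", the first is `Σ¹₂` and the second `Π¹₂` (`Program.isDelta12_eval`). Triples of
numbers are coded by a polynomial, hence by a term, which makes the definability of all these
conditions a matter of closure properties (`IsArith`).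
-/

namespace ITTM

open FirstOrder

/-! ### Arithmetical definability -/

/-- The number-valued function `f` of the number variables indexed by `α` is the value of a term of
the language of arithmetic. -/
def IsTerm (ι : Type) {α : Type} (f : (α → ℕ) → ℕ) : Prop :=
  ∃ t : (arithLang ι).Term α, ∀ (X : ι → Cantor) (v : α → ℕ),
    letI := arithStructure X
    t.realize v = f v

/-- The predicate `P` of reals indexed by `ι` and of numbers indexed by `α` is defined by an
arithmetical formula, uniformly in the reals. -/
def IsArith {ι α : Type} (P : (ι → Cantor) → (α → ℕ) → Prop) : Prop :=
  ∃ φ : (arithLang ι).Formula α, ∀ (X : ι → Cantor) (v : α → ℕ),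
    letI := arithStructure X
    φ.Realize v ↔ P X v

section Terms

variable {ι α : Type} {f g : (α → ℕ) → ℕ}

theorem IsTerm.var (i : α) : IsTerm ι fun v => v i :=
  ⟨Language.Term.var i, fun _ _ => rfl⟩

theorem IsTerm.zero : IsTerm ι fun _ : α → ℕ => 0 :=
  ⟨Language.Term.func (L := arithLang ι) (l := 0) ArithFunc.zero ![], fun _ _ => rfl⟩

theorem IsTerm.one : IsTerm ι fun _ : α → ℕ => 1 :=
  ⟨Language.Term.func (L := arithLang ι) (l := 0) ArithFunc.one ![], fun _ _ => rfl⟩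

theorem IsTerm.add (hf : IsTerm ι f) (hg : IsTerm ι g) : IsTerm ι fun v => f v + g v := by
  obtain ⟨s, hs⟩ := hf
  obtain ⟨t, ht⟩ := hg
  refine ⟨Language.Term.func (L := arithLang ι) (l := 2) ArithFunc.add ![s, t], fun X v => ?_⟩
  exact congrArg₂ (· + ·) (hs X v) (ht X v)

theorem IsTerm.mul (hf : IsTerm ι f) (hg : IsTerm ι g) : IsTerm ι fun v => f v * g v := by
  obtain ⟨s, hs⟩ := hf
  obtain ⟨t, ht⟩ := hg
  refine ⟨Language.Term.func (L := arithLang ι) (l := 2) ArithFunc.mul ![s, t], fun X v => ?_⟩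
  exact congrArg₂ (· * ·) (hs X v) (ht X v)

theorem IsTerm.const (n : ℕ) : IsTerm ι fun _ : α → ℕ => n := by
  induction n with
  | zero => exact IsTerm.zero
  | succ n ih => exact ih.add IsTerm.one

end Terms

namespace IsArith

variable {ι α : Type} {P Q : (ι → Cantor) → (α → ℕ) → Prop}

theorem congr (hP : IsArith P) (h : ∀ X v, P X v ↔ Q X v) : IsArith Q := by
  obtain ⟨φ, hφ⟩ := hP
  exact ⟨φ, fun X v => (hφ X v).trans (h X v)⟩

theorem mem {f : (α → ℕ) → ℕ} (i : ι) (hf : IsTerm ι f) :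
    IsArith fun (X : ι → Cantor) v => X i (f v) = true := by
  obtain ⟨t, ht⟩ := hf
  refine ⟨Language.Relations.formula (L := arithLang ι) (n := 1) (ArithRel.mem i) ![t],
    fun X v => ?_⟩
  let := arithStructure X
  exact Language.Formula.realize_rel.trans
    (Iff.of_eq (congrArg (fun n => X i n = true) (ht X v)))

theorem eq {f g : (α → ℕ) → ℕ} (hf : IsTerm ι f) (hg : IsTerm ι g) :
    IsArith fun (_ : ι → Cantor) v => f v = g v := by
  obtain ⟨s, hs⟩ := hf
  obtain ⟨t, ht⟩ := hg
  refine ⟨s.equal t, fun X v => ?_⟩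
  let := arithStructure X
  rw [Language.Formula.realize_equal, hs X v, ht X v]

theorem not (hP : IsArith P) : IsArith fun X v => ¬P X v := by
  obtain ⟨φ, hφ⟩ := hP
  refine ⟨φ.not, fun X v => ?_⟩
  let := arithStructure X
  rw [Language.Formula.realize_not, hφ X v]

theorem and (hP : IsArith P) (hQ : IsArith Q) : IsArith fun X v => P X v ∧ Q X v := by
  obtain ⟨φ, hφ⟩ := hP
  obtain ⟨ψ, hψ⟩ := hQ
  refine ⟨φ ⊓ ψ, fun X v => ?_⟩
  let := arithStructure X
  rw [Language.Formula.realize_inf, hφ X v, hψ X v]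

theorem or (hP : IsArith P) (hQ : IsArith Q) : IsArith fun X v => P X v ∨ Q X v :=
  (hP.not.and hQ.not).not.congr fun _ _ => by tauto

theorem imp (hP : IsArith P) (hQ : IsArith Q) : IsArith fun X v => P X v → Q X v :=
  (hP.not.or hQ).congr fun _ _ => by tauto

theorem iff (hP : IsArith P) (hQ : IsArith Q) : IsArith fun X v => (P X v ↔ Q X v) :=
  ((hP.imp hQ).and (hQ.imp hP)).congr fun _ _ => by tauto

theorem const (p : Prop) : IsArith fun (_ : ι → Cantor) (_ : α → ℕ) => p := by
  have h : IsArith fun (_ : ι → Cantor) (_ : α → ℕ) => (0 : ℕ) = 0 := eq IsTerm.zero IsTerm.zero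
  by_cases hp : p
  · exact h.congr fun _ _ => by simp [hp]
  · exact h.not.congr fun _ _ => by simp [hp]

/-- Conjunctions over a finite index type. -/
theorem finAll {β : Type} [Finite β] {P : β → (ι → Cantor) → (α → ℕ) → Prop}
    (hP : ∀ b, IsArith (P b)) : IsArith fun X v => ∀ b, P b X v := by
  choose φ hφ using hP
  refine ⟨Language.Formula.iInf φ, fun X v => ?_⟩
  let := arithStructure X
  rw [Language.Formula.realize_iInf]
  exact forall_congr' fun b => hφ b X v

/-- Number quantifiers: the quantified variable is added to the index type `α`. -/
theorem ex {P : (ι → Cantor) → (α → ℕ) → ℕ → Prop}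
    (hP : IsArith fun X (v : α ⊕ Unit → ℕ) => P X (fun i => v (Sum.inl i)) (v (Sum.inr ()))) :
    IsArith fun X v => ∃ n, P X v n := by
  obtain ⟨φ, hφ⟩ := hP
  refine ⟨φ.iExs Unit, fun X v => ?_⟩
  let := arithStructure X
  rw [Language.Formula.realize_iExs]
  constructor
  · rintro ⟨w, hw⟩
    exact ⟨w (), (hφ X _).1 hw⟩
  · rintro ⟨n, hn⟩
    exact ⟨fun _ => n, (hφ X _).2 hn⟩

theorem all {P : (ι → Cantor) → (α → ℕ) → ℕ → Prop}
    (hP : IsArith fun X (v : α ⊕ Unit → ℕ) => P X (fun i => v (Sum.inl i)) (v (Sum.inr ()))) :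
    IsArith fun X v => ∀ n, P X v n :=
  (ex (P := fun X v n => ¬P X v n) hP.not).not.congr fun _ _ => by simp

theorem exists_sentence {P : (ι → Cantor) → Prop}
    (hP : IsArith fun X (_ : Empty → ℕ) => P X) :
    ∃ φ : (arithLang ι).Sentence, ∀ X, ArithTrue φ X ↔ P X := by
  obtain ⟨φ, hφ⟩ := hP
  exact ⟨φ, fun X => hφ X _⟩

end IsArith

/-! ### Halting and looping below the first uncountable ordinal -/

open Ordinal Order

instance (k : ℕ) : Finite (Tape k) :=
  Finite.of_surjective
    (fun o : Option (Option (Fin k)) => match o with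
      | none => Tape.scratch
      | some none => Tape.output
      | some (some i) => Tape.input i)
    fun t => match t with
      | Tape.input i => ⟨some (some i), rfl⟩
      | Tape.scratch => ⟨none, rfl⟩
      | Tape.output => ⟨some none, rfl⟩

instance (n : ℕ) : Finite (State n) :=
  Finite.of_surjective
    (fun o : Fin 3 ⊕ Fin n => match o with
      | Sum.inl 0 => State.start
      | Sum.inl 1 => State.limit
      | Sum.inl 2 => State.halt
      | Sum.inr i => State.aux i)
    fun t => match t with
      | State.start => ⟨Sum.inl 0, rfl⟩
      | State.limit => ⟨Sum.inl 1, rfl⟩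
      | State.halt => ⟨Sum.inl 2, rfl⟩
      | State.aux i => ⟨Sum.inr i, rfl⟩

theorem Config.eq_of_fields {k n : ℕ} {c d : Config k n} (hs : c.state = d.state)
    (hh : c.head = d.head) (hc : ∀ t i, c.cells t i = d.cells t i) : c = d := by
  obtain ⟨s, h, l⟩ := c
  obtain ⟨s', h', l'⟩ := d
  simp only at hs hh hc
  subst hs hh
  congr
  funext t i
  exact hc t i

namespace Program

variable {k : ℕ} (p : Program k) (x : Fin k → Cantor)

theorem run_zero : p.run x 0 = p.init x := Ordinal.limitRecOn_zero _ _ _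

theorem run_add_one (a : Ordinal.{0}) : p.run x (a + 1) = p.step (p.run x a) :=
  Ordinal.limitRecOn_add_one _ _ _ _

theorem run_limit {a : Ordinal.{0}} (h : IsSuccLimit a) :
    p.run x a = p.limitConfig a fun b _ => p.run x b :=
  Ordinal.limitRecOn_limit _ _ _ _ h

theorem run_limit_state {a : Ordinal.{0}} (h : IsSuccLimit a) :
    (p.run x a).state = State.limit := by
  rw [run_limit p x h]; rfl

theorem run_limit_head {a : Ordinal.{0}} (h : IsSuccLimit a) : (p.run x a).head = 0 := by
  rw [run_limit p x h]; rfl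

theorem limitConfig_cells_eq_false {a : Ordinal.{0}} {t : Tape k} {i : ℕ} :
    (p.limitConfig a fun b _ => p.run x b).cells t i = false ↔
      ∃ b < a, ∀ d, b ≤ d → d < a → (p.run x d).cells t i = false := by
  simp [limitConfig]

theorem run_limit_cells {a : Ordinal.{0}} (h : IsSuccLimit a) {t : Tape k} {i : ℕ} :
    (p.run x a).cells t i = false ↔
      ∃ b < a, ∀ d, b ≤ d → d < a → (p.run x d).cells t i = false := by
  rw [run_limit p x h, limitConfig_cells_eq_false]

/-- The computation from a stage on depends only on the configuration at that stage. -/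
theorem run_add_eq {a b : Ordinal.{0}} (h : p.run x a = p.run x b) (r : Ordinal.{0}) :
    p.run x (a + r) = p.run x (b + r) := by
  induction r using Ordinal.limitRecOn with
  | zero => simpa using h
  | add_one r ih => rw [← add_assoc, ← add_assoc, run_add_one, run_add_one, ih]
  | limit r hr ih =>
    -- A cell is 0 at the limit iff it is 0 on a final segment, and final segments of `[a, a + r)`
    -- and `[b, b + r)` correspond to each other.
    have key : ∀ a b : Ordinal.{0}, (∀ s < r, p.run x (a + s) = p.run x (b + s)) →
        ∀ t i, (p.run x (a + r)).cells t i = false → (p.run x (b + r)).cells t i = false := by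
      intro a b ih t i
      rw [run_limit_cells p x (isSuccLimit_add a hr), run_limit_cells p x (isSuccLimit_add b hr)]
      rintro ⟨e, he, H⟩
      obtain ⟨s, hs, hes⟩ : ∃ s < r, e ≤ a + s := by
        rcases le_total e a with h | h
        · exact ⟨0, hr.bot_lt, by simpa using h⟩
        · refine ⟨e - a, ?_, (Ordinal.add_sub_cancel_of_le h).ge⟩
          rwa [← add_lt_add_iff_left a, Ordinal.add_sub_cancel_of_le h]
      refine ⟨b + s, by gcongr, fun d hd hdr => ?_⟩
      obtain ⟨u, rfl⟩ := exists_add_of_le ((le_self_add).trans hd)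
      have hu : u < r := by simpa using hdr
      have hsu : s ≤ u := by simpa using hd
      rw [← ih u hu]
      exact H _ (hes.trans (by gcongr)) (by gcongr)
    refine Config.eq_of_fields ?_ ?_ fun t i => ?_
    · rw [run_limit_state p x (isSuccLimit_add a hr), run_limit_state p x (isSuccLimit_add b hr)]
    · rw [run_limit_head p x (isSuccLimit_add a hr), run_limit_head p x (isSuccLimit_add b hr)]
    · have h1 := key a b (fun s hs => ih s hs) t i
      have h2 := key b a (fun s hs => (ih s hs).symm) t i
      rw [Bool.eq_iff_iff]
      grind

/-- The computation is caught in a loop between the stages `a` and `b`: the two configurations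
agree and look like those at limit stages, and each cell with content 0 at stage `a` stays 0 up to
stage `b`. The last condition makes the configuration reappear also at limits of repetitions. -/
structure IsLoop (a b : Ordinal.{0}) : Prop where
  lt : a < b
  eq : p.run x a = p.run x b
  state : (p.run x a).state = State.limit
  head : (p.run x a).head = 0
  zero : ∀ t i, (p.run x a).cells t i = false →
    ∀ d, a ≤ d → d < b → (p.run x d).cells t i = false

variable {p x}

theorem IsLoop.exists_run_eq {a b : Ordinal.{0}} (h : p.IsLoop x a b) {c : Ordinal.{0}}
    (hc : a ≤ c) : ∃ d, a ≤ d ∧ d < b ∧ p.run x c = p.run x d := by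
  obtain ⟨l, rfl⟩ := exists_add_of_le h.lt.le
  have hl : l ≠ 0 := by rintro rfl; simpa using h.lt
  -- A stage from `a` on has the form `a + l * q + r` with `r < l`, where `l` is the length of the
  -- loop. It suffices that the configuration at `a` is repeated at each `a + l * q`.
  have decomp : ∀ q, p.run x (a + l * q) = p.run x a → ∀ r, r < l →
      p.run x (a + (l * q + r)) = p.run x (a + r) := fun q hq r _ => by
    rw [← add_assoc]; exact run_add_eq p x hq r
  have period : ∀ q : Ordinal.{0}, p.run x (a + l * q) = p.run x a := by
    intro q
    induction q using Ordinal.limitRecOn with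
    | zero => simp
    | add_one q ih => rw [mul_add_one, ← add_assoc, run_add_eq p x ih, ← h.eq]
    | limit q hq ih =>
      have hlim : IsSuccLimit (a + l * q) :=
        isSuccLimit_add a (isSuccLimit_mul_right (pos_iff_ne_zero.2 hl) hq)
      refine Config.eq_of_fields ?_ ?_ fun t i => ?_
      · rw [run_limit_state p x hlim, h.state]
      · rw [run_limit_head p x hlim, h.head]
      have key : (p.run x (a + l * q)).cells t i = false ↔ (p.run x a).cells t i = false := by
        rw [run_limit_cells p x hlim]
        constructor
        · rintro ⟨e, he, H⟩
          obtain ⟨s, hs, hes⟩ : ∃ s < q, e ≤ a + l * s := by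
            rcases le_total e a with h | h
            · exact ⟨0, hq.bot_lt, by simpa using h⟩
            · obtain ⟨u, rfl⟩ := exists_add_of_le h
              have hu : u < l * q := by simpa using he
              obtain ⟨s, hs, hus⟩ := (lt_mul_iff_of_isSuccLimit hq).1 hu
              exact ⟨s, hs, by gcongr⟩
          rw [← ih s hs]
          exact H _ hes (by gcongr)
        · -- Up to stage `a + l * q` all configurations occur between `a` and `b`.
          intro h0
          refine ⟨a, lt_add_of_pos_right a (mul_pos (pos_iff_ne_zero.2 hl) hq.bot_lt), fun d had hd => ?_⟩
          obtain ⟨u, rfl⟩ := exists_add_of_le had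
          have hu : u < l * q := by simpa using hd
          have hr := Ordinal.mod_lt u hl
          rw [← Ordinal.div_add_mod u l,
            decomp _ (ih _ ((Ordinal.lt_mul_iff_div_lt hl).1 hu)) _ hr]
          exact h.zero t i h0 _ le_self_add (by gcongr)
      rw [Bool.eq_iff_iff]
      grind
  obtain ⟨u, rfl⟩ := exists_add_of_le hc
  have hr := Ordinal.mod_lt u hl
  refine ⟨a + u % l, le_self_add, by gcongr, ?_⟩
  conv_lhs => rw [← Ordinal.div_add_mod u l]
  exact decomp _ (period _) _ hr

/-- A loop that does not pass through the halt state is never left. -/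
theorem IsLoop.haltStages_eq_empty {a b : Ordinal.{0}} (h : p.IsLoop x a b)
    (hb : ∀ d < b, (p.run x d).state ≠ State.halt) : p.haltStages x = ∅ := by
  refine Set.eq_empty_of_forall_notMem fun c hc => ?_
  rcases lt_or_ge c a with hca | hca
  · exact hb c (hca.trans h.lt) hc
  · obtain ⟨d, -, hdb, hd⟩ := h.exists_run_eq hca
    exact hb d hdb (hd ▸ hc)

variable (p x)

/-- Cofinally many countable limit stages have the configuration of stage `ω₁`: close off, in `ω`
steps, under passing to later occurrences of 1 in each of the cells that are 1 cofinally often. -/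
theorem exists_run_eq_run_omega_one {b₀ : Ordinal.{0}} (hb₀ : b₀ < ω₁)
    (hzero : ∀ t i, (p.run x ω₁).cells t i = false →
      ∀ d, b₀ ≤ d → d < ω₁ → (p.run x d).cells t i = false) :
    ∃ a, b₀ < a ∧ a < ω₁ ∧ IsSuccLimit a ∧ p.run x a = p.run x ω₁ := by
  have hlim : IsSuccLimit (ω₁ : Ordinal.{0}) := Cardinal.isSuccLimit_omega 1
  have next : ∀ d : Ordinal.{0}, ∃ e, d < ω₁ → d < e ∧ e < ω₁ ∧
      ∀ t i, (p.run x ω₁).cells t i = true →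
        ∃ c, d ≤ c ∧ c < e ∧ (p.run x c).cells t i = true := by
    intro d
    by_cases hd : d < ω₁
    swap
    · exact ⟨0, fun h => absurd h hd⟩
    have occ : ∀ s : Tape k × ℕ, ∃ c, d ≤ c ∧ c < ω₁ ∧
        ((p.run x ω₁).cells s.1 s.2 = true → (p.run x c).cells s.1 s.2 = true) := by
      intro s
      by_cases hs : (p.run x ω₁).cells s.1 s.2 = true
      swap
      · exact ⟨d, le_rfl, hd, fun h => absurd h hs⟩
      have := (run_limit_cells p x hlim (t := s.1) (i := s.2)).not.1 (by simp [hs])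
      push Not at this
      obtain ⟨c, h1, h2, h3⟩ := this d hd
      exact ⟨c, h1, h2, fun _ => by simpa using h3⟩
    choose c hc1 hc2 hc3 using occ
    have hlt : ∀ s, c s + 1 < ω₁ := fun s => hlim.succ_lt (hc2 s)
    have hbdd : BddAbove (Set.range fun s => c s + 1) := Ordinal.bddAbove_of_small
    refine ⟨⨆ s, (c s + 1), fun _ => ⟨?_, Ordinal.iSup_lt_omega_one hlt, fun t i h => ?_⟩⟩
    · exact (hc1 (Tape.scratch, 0)).trans_lt
        ((lt_add_one _).trans_le (le_ciSup hbdd (Tape.scratch, 0)))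
    · exact ⟨c (t, i), hc1 _, (lt_add_one _).trans_le (le_ciSup hbdd (t, i)), hc3 _ h⟩
  choose e he using next
  let s : ℕ → Ordinal.{0} := fun n => e^[n] b₀
  have hs_succ : ∀ n, s (n + 1) = e (s n) := fun n => Function.iterate_succ_apply' e n b₀
  have hs : ∀ n, s n < ω₁ := by
    intro n
    induction n with
    | zero => exact hb₀
    | succ n ih => rw [hs_succ]; exact (he _ ih).2.1
  have hbdd : BddAbove (Set.range s) := Ordinal.bddAbove_of_small
  have hlt : ∀ n, s n < s (n + 1) := fun n => by rw [hs_succ]; exact (he _ (hs n)).1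
  have hlt' : ∀ n, s n < ⨆ n, s n := fun n => (hlt n).trans_le (le_ciSup hbdd (n + 1))
  have ha : ⨆ n, s n < ω₁ := Ordinal.iSup_lt_omega_one hs
  have halim : IsSuccLimit (⨆ n, s n) := by
    rw [isSuccLimit_iff, isSuccPrelimit_iff_succ_lt]
    refine ⟨fun h => ?_, fun c hc => ?_⟩
    · exact not_lt_bot (a := s 0) ((hlt' 0).trans_eq h)
    · obtain ⟨n, hn⟩ := (lt_ciSup_iff hbdd).1 hc
      exact (succ_le_of_lt hn).trans_lt (hlt' n)
  refine ⟨⨆ n, s n, hlt' 0, ha, halim, Config.eq_of_fields ?_ ?_ fun t i => ?_⟩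
  · rw [run_limit_state p x hlim, run_limit_state p x halim]
  · rw [run_limit_head p x hlim, run_limit_head p x halim]
  cases hc : (p.run x ω₁).cells t i with
  | false =>
    rw [run_limit_cells p x halim]
    exact ⟨b₀, hlt' 0, fun d h1 h2 => hzero t i hc d h1 (h2.trans ha)⟩
  | true =>
    rw [← Bool.not_eq_false, run_limit_cells p x halim]
    rintro ⟨b, hb, H⟩
    obtain ⟨n, hn⟩ := (lt_ciSup_iff hbdd).1 hb
    obtain ⟨c, h1, h2, h3⟩ := (he _ (hs n)).2.2 t i hc
    rw [← hs_succ] at h2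
    simp [H c (hn.le.trans h1) (h2.trans (hlt' _))] at h3

/-- Whether or not the machine halts, its run contains a loop between two countable stages. -/
theorem exists_isLoop_lt_omega_one : ∃ a b, b < ω₁ ∧ p.IsLoop x a b := by
  have hlim : IsSuccLimit (ω₁ : Ordinal.{0}) := Cardinal.isSuccLimit_omega 1
  have stab : ∀ s : Tape k × ℕ, ∃ b < (ω₁ : Ordinal.{0}), (p.run x ω₁).cells s.1 s.2 = false →
      ∀ d, b ≤ d → d < ω₁ → (p.run x d).cells s.1 s.2 = false := by
    intro s
    by_cases hs : (p.run x ω₁).cells s.1 s.2 = false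
    · obtain ⟨b, hb, H⟩ := (run_limit_cells p x hlim).1 hs
      exact ⟨b, hb, fun _ => H⟩
    · exact ⟨0, hlim.bot_lt, fun h => absurd h hs⟩
  choose c hc1 hc2 using stab
  have hbdd : BddAbove (Set.range c) := Ordinal.bddAbove_of_small
  have hzero : ∀ b, ⨆ s, c s ≤ b → ∀ t i, (p.run x ω₁).cells t i = false →
      ∀ d, b ≤ d → d < ω₁ → (p.run x d).cells t i = false := fun b hb t i h d h1 h2 =>
    hc2 (t, i) h d ((le_ciSup hbdd (t, i)).trans (hb.trans h1)) h2
  obtain ⟨a, ha1, ha2, halim, ha⟩ :=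
    p.exists_run_eq_run_omega_one x (Ordinal.iSup_lt_omega_one hc1) (hzero _ le_rfl)
  obtain ⟨b, hb1, hb2, -, hb⟩ := p.exists_run_eq_run_omega_one x ha2 (hzero _ ha1.le)
  refine ⟨a, b, hb2, hb1, ha.trans hb.symm, p.run_limit_state x halim, p.run_limit_head x halim,
    fun t i h d h1 h2 => ?_⟩
  rw [ha] at h
  exact hzero _ ha1.le t i h d h1 (h2.trans hb2)

end Program

/-! ### Coding computations by reals -/

/-- An injective code for triples of numbers, given by a term of the language of arithmetic: the
pairing function `(a + b) ^ 2 + a` is used twice. -/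
def tripleCode (c a b : ℕ) : ℕ :=
  (c + ((a + b) * (a + b) + a)) * (c + ((a + b) * (a + b) + a)) + c

/-- The pairing function underlying `tripleCode` is injective: `(a + b) ^ 2 + a` lies between the
squares of `a + b` and of `a + b + 1`. -/
theorem sq_add_inj {a b c d : ℕ} (h : (a + b) * (a + b) + a = (c + d) * (c + d) + c) :
    a = c ∧ b = d := by
  have : a + b = c + d := by
    rcases lt_trichotomy (a + b) (c + d) with h1 | h1 | h1
    · nlinarith
    · exact h1
    · nlinarith
  rw [this] at h
  omega

theorem tripleCode_inj {c a b c' a' b' : ℕ} :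
    tripleCode c a b = tripleCode c' a' b' ↔ c = c' ∧ a = a' ∧ b = b' := by
  constructor
  · intro h
    obtain ⟨h1, h2⟩ := sq_add_inj h
    exact ⟨h1, sq_add_inj h2⟩
  · rintro ⟨rfl, rfl, rfl⟩
    rfl

theorem exists_tripleCode (P : ℕ → ℕ → ℕ → Prop) :
    ∃ y : Cantor, ∀ c a b, y (tripleCode c a b) = true ↔ P c a b := by
  classical
  refine ⟨fun n => decide (∃ c a b, n = tripleCode c a b ∧ P c a b), fun c a b => ?_⟩
  simp only [decide_eq_true_eq, tripleCode_inj]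
  constructor
  · rintro ⟨_, _, _, ⟨rfl, rfl, rfl⟩, h⟩
    exact h
  · exact fun h => ⟨c, a, b, ⟨rfl, rfl, rfl⟩, h⟩

/-- A number for each state. -/
def State.code {n : ℕ} : State n → ℕ
  | start => 0
  | limit => 1
  | halt => 2
  | aux i => i + 3

/-- A number for each tape. The numbers 0, 1, 2 are left for the other components of a coded
computation. -/
def Tape.code {k : ℕ} : Tape k → ℕ
  | scratch => 3
  | output => 4
  | input i => i + 5

theorem State.code_injective {n : ℕ} : Function.Injective (State.code (n := n)) := by
  intro s t h
  cases s <;> cases t <;> simp only [State.code] at h <;> first | rfl | omega | skip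
  congr 1
  omega

theorem Tape.code_injective {k : ℕ} : Function.Injective (Tape.code (k := k)) := by
  intro s t h
  cases s <;> cases t <;> simp only [Tape.code] at h <;> first | rfl | omega | skip
  congr 1
  omega

/-- The numbers are names of stages. According to `y`, the stage named `a` comes before the stage
named `b`. -/
def Before (y : Cantor) (a b : ℕ) : Prop := y (tripleCode 0 a b) = true

/-- According to `y`, the head is on cell `h` at the stage named `a`. -/
def HeadAt (y : Cantor) (a h : ℕ) : Prop := y (tripleCode 1 a h) = true

/-- According to `y`, the machine is in state `q` at the stage named `a`. -/
def StateAt {n : ℕ} (y : Cantor) (a : ℕ) (q : State n) : Prop :=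
  y (tripleCode 2 a q.code) = true

/-- According to `y`, cell `i` of tape `t` has content 1 at the stage named `a`. -/
def CellAt {k : ℕ} (y : Cantor) (t : Tape k) (a i : ℕ) : Prop :=
  y (tripleCode t.code a i) = true

/-- The configuration at the stage named `a` is `c`, according to `y`. -/
structure CodesConfig {k n : ℕ} (y : Cantor) (a : ℕ) (c : Config k n) : Prop where
  state : ∀ q : State n, StateAt y a q ↔ q = c.state
  head : ∀ h, HeadAt y a h ↔ h = c.head
  cells : ∀ t i, CellAt y t a i ↔ c.cells t i = true

namespace Program

variable {k : ℕ} (p : Program k) (x : Fin k → Cantor) (y : Cantor)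

/-- The arithmetical condition that `y` has the initial configuration at the stage named `a`. -/
def InitAt (a : ℕ) : Prop :=
  (∀ q : State p.numAux, StateAt y a q ↔ q = State.start) ∧ (∀ h, HeadAt y a h ↔ h = 0) ∧
    (∀ j i, CellAt y (Tape.input j : Tape k) a i ↔ x j i = true) ∧
    (∀ i, ¬CellAt y (Tape.scratch : Tape k) a i) ∧ ∀ i, ¬CellAt y (Tape.output : Tape k) a i

/-- The arithmetical condition that `y` makes one step of `p` between the stages named `b` and
`a`. -/
def StepAt (b a : ℕ) : Prop :=
  ∀ (q : State p.numAux) (u : Tape k → Bool), StateAt y b q → ∀ h, HeadAt y b h →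
    (∀ t, CellAt y t b h ↔ u t = true) →
    (∀ q', StateAt y a q' ↔ q' = (p.table q u).2.2) ∧
    (∀ h', HeadAt y a h' ↔ h' = moveHead (p.table q u).2.1 h) ∧
    ∀ t i, CellAt y t a i ↔
      (i = h ∧ (p.table q u).1 t = true) ∨ (¬i = h ∧ CellAt y t b i)

/-- The arithmetical condition that `y` takes a limit at the stage named `a`. -/
def LimitAt (a : ℕ) : Prop :=
  (∀ q : State p.numAux, StateAt y a q ↔ q = State.limit) ∧ (∀ h, HeadAt y a h ↔ h = 0) ∧
    ∀ (t : Tape k) i, CellAt y t a i ↔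
      ¬∃ b, Before y b a ∧ ∀ d, ¬Before y d b → Before y d a → ¬CellAt y t d i

/-- The arithmetical condition that `y` follows at the stage named `a` the rules for a computation
of `p` on input `x`. -/
def CoherentAt (a : ℕ) : Prop :=
  ((∀ b, ¬Before y b a) → p.InitAt x y a) ∧
  (∀ b, Before y b a → (∀ c, Before y b c → ¬Before y c a) → p.StepAt y b a) ∧
  ((∃ b, Before y b a) → (∀ b, Before y b a → ∃ c, Before y b c ∧ Before y c a) → p.LimitAt y a)

variable {p x y}

theorem initAt_iff {a : ℕ} : p.InitAt x y a ↔ CodesConfig y a (p.init x) := by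
  constructor
  · rintro ⟨h1, h2, h3, h4, h5⟩
    refine ⟨h1, h2, fun t i => ?_⟩
    cases t with
    | input j => exact h3 j i
    | scratch => simpa [init] using h4 i
    | output => simpa [init] using h5 i
  · rintro ⟨h1, h2, h3⟩
    exact ⟨h1, h2, fun j i => h3 _ i, fun i => by simpa [init] using (h3 Tape.scratch i).not,
      fun i => by simpa [init] using (h3 Tape.output i).not⟩

theorem stepAt_iff {a b : ℕ} {c : Config k p.numAux} (hb : CodesConfig y b c) :
    p.StepAt y b a ↔ CodesConfig y a (p.step c) := by
  have cell : ∀ t i, (p.step c).cells t i = true ↔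
      (i = c.head ∧ (p.table c.state (fun t => c.cells t c.head)).1 t = true) ∨
        (¬i = c.head ∧ CellAt y t b i) := fun t i => by
    rw [hb.cells]
    by_cases h : i = c.head
    · subst h; simp [step]
    · simp [step, h]
  constructor
  · intro h
    obtain ⟨h1, h2, h3⟩ := h c.state (fun t => c.cells t c.head) ((hb.state _).2 rfl) c.head
      ((hb.head _).2 rfl) (fun t => hb.cells t _)
    exact ⟨h1, h2, fun t i => (h3 t i).trans (cell t i).symm⟩
  · rintro ⟨h1, h2, h3⟩ q u hq h hh hu
    obtain rfl := (hb.state q).1 hq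
    obtain rfl := (hb.head h).1 hh
    obtain rfl : u = fun t => c.cells t c.head := funext fun t => by
      rw [Bool.eq_iff_iff, ← hu t, hb.cells]
    exact ⟨h1, h2, fun t i => (h3 t i).trans (cell t i)⟩

end Program

/-- The names of stages are interpreted by ordinals, which form an initial segment, in such a way
that `Before y` is the order of the ordinals. -/
structure Enumerates (y : Cantor) (g : ℕ → Ordinal.{0}) : Prop where
  before_iff : ∀ a b, Before y a b ↔ g a < g b
  surj : ∀ a, ∀ o < g a, ∃ b, g b = o

namespace Program

variable {k : ℕ} {p : Program k} {x : Fin k → Cantor} {y : Cantor} {g : ℕ → Ordinal.{0}}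

/-- If `y` is right about the earlier stages, then it follows the rules at a stage if and only if it
is right about that stage: the three clauses of `CoherentAt` recognize from `Before y` whether the
stage is zero, a successor or a limit. -/
theorem coherentAt_iff (hg : Enumerates y g) {a : ℕ}
    (ih : ∀ b, g b < g a → CodesConfig y b (p.run x (g b))) :
    p.CoherentAt x y a ↔ CodesConfig y a (p.run x (g a)) := by
  simp only [CoherentAt, hg.before_iff]
  rcases Ordinal.zero_or_succ_or_isSuccLimit (g a) with h0 | ⟨o, ho⟩ | hlim
  · have none : ∀ b, ¬g b < g a := fun b => by simp [h0]
    simp only [none]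
    rw [h0, run_zero, ← initAt_iff]
    simp
  · obtain ⟨b, hb⟩ := hg.surj a o (by rw [← ho]; exact lt_succ o)
    have hba : g a = g b + 1 := by rw [hb, ← ho]; rfl
    have hlt : g b < g a := by rw [hba]; exact lt_add_one _
    have hlast : ∀ c, g b < g c → ¬g c < g a := fun c h1 h2 => by
      rw [hba, Order.lt_add_one_iff] at h2
      exact h2.not_gt h1
    rw [hba, run_add_one, ← stepAt_iff (ih b hlt), ← hba]
    constructor
    · exact fun h => h.2.1 b hlt hlast
    · refine fun h => ⟨fun hn => absurd hlt (hn b), fun c hc hc' => ?_, fun _ H => ?_⟩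
      · have hcb : g c = g b := by
          refine le_antisymm ?_ (not_lt.1 fun h => hc' b h hlt)
          rwa [hba, Order.lt_add_one_iff] at hc
        rw [stepAt_iff (ih c hc), hcb, ← stepAt_iff (ih b hlt)]
        exact h
      · obtain ⟨c, h1, h2⟩ := H b hlt
        exact absurd h2 (hlast c h1)
  · obtain ⟨z, hz⟩ := hg.surj a 0 hlim.bot_lt
    have hza : g z < g a := by rw [hz]; exact hlim.bot_lt
    have hnext : ∀ b, g b < g a → ∃ c, g b < g c ∧ g c < g a := fun b hb => by
      obtain ⟨c, hc⟩ := hg.surj a _ (hlim.succ_lt hb)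
      exact ⟨c, hc ▸ lt_succ _, hc ▸ hlim.succ_lt hb⟩
    have hiff : p.LimitAt y a ↔ CodesConfig y a (p.run x (g a)) := by
      have cell : ∀ (t : Tape k) i, (¬∃ b, Before y b a ∧ ∀ d, ¬Before y d b → Before y d a →
          ¬CellAt y t d i) ↔ (p.run x (g a)).cells t i = true := fun t i => by
        rw [← Bool.not_eq_false, run_limit_cells p x hlim, not_iff_not]
        simp only [hg.before_iff, not_lt]
        constructor
        · rintro ⟨b, hb, H⟩
          refine ⟨g b, hb, fun d h1 h2 => ?_⟩
          obtain ⟨d, rfl⟩ := hg.surj a d h2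
          simpa [(ih d h2).cells] using H d h1 h2
        · rintro ⟨b, hb, H⟩
          obtain ⟨b, rfl⟩ := hg.surj a b hb
          exact ⟨b, hb, fun d h1 h2 => by simpa [(ih d h2).cells] using H _ h1 h2⟩
      constructor
      · rintro ⟨h1, h2, h3⟩
        exact ⟨by rwa [run_limit_state p x hlim], by rwa [run_limit_head p x hlim],
          fun t i => (h3 t i).trans (cell t i)⟩
      · rintro ⟨h1, h2, h3⟩
        exact ⟨by rwa [run_limit_state p x hlim] at h1, by rwa [run_limit_head p x hlim] at h2,
          fun t i => (h3 t i).trans (cell t i).symm⟩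
    rw [← hiff]
    constructor
    · exact fun h => h.2.2 ⟨z, hza⟩ hnext
    · refine fun h => ⟨fun hn => absurd hza (hn z), fun c hc hc' => ?_, fun _ _ => h⟩
      obtain ⟨d, h1, h2⟩ := hnext c hc
      exact absurd h2 (hc' d h1)

theorem forall_coherentAt_iff (hg : Enumerates y g) :
    (∀ a, p.CoherentAt x y a) ↔ ∀ a, CodesConfig y a (p.run x (g a)) := by
  constructor
  · intro h a
    induction ho : g a using WellFoundedLT.induction generalizing a with
    | ind o ih =>
      subst ho
      exact (coherentAt_iff hg fun b hb => ih _ hb b rfl).1 (h a)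
  · exact fun h a => (coherentAt_iff hg fun b _ => h b).2 (h a)

end Program

/-- The arithmetical condition that `Before y` is a strict linear order of the numbers. -/
def IsLinear (y : Cantor) : Prop :=
  (∀ a, ¬Before y a a) ∧ (∀ a b c, Before y a b → Before y b c → Before y a c) ∧
    ∀ a b, Before y a b ∨ a = b ∨ Before y b a

/-- The arithmetical condition that the set `z`, if it is not empty, has a first element. -/
def HasFirst (y z : Cantor) : Prop :=
  (∃ a, z a = true) → ∃ a, z a = true ∧ ∀ b, z b = true → ¬Before y b a

theorem exists_enumerates {y : Cantor} (hy : IsLinear y) (hz : ∀ z, HasFirst y z) :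
    ∃ g, Enumerates y g := by
  classical
  obtain ⟨hirr, htrans, htri⟩ := hy
  have hwf : WellFounded (Before y) := WellFounded.wellFounded_iff_has_min.2 fun s ⟨a, ha⟩ => by
    obtain ⟨m, hm, H⟩ := hz (fun n => decide (n ∈ s)) ⟨a, by simpa using ha⟩
    exact ⟨m, by simpa using hm, fun b hb => H b (by simpa using hb)⟩
  have : Std.Irrefl (Before y) := ⟨hirr⟩
  have : IsTrans ℕ (Before y) := ⟨htrans⟩
  have : Std.Trichotomous (Before y) := ⟨fun a b h1 h2 => by grind⟩
  have : IsWellFounded ℕ (Before y) := ⟨hwf⟩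
  have : IsWellOrder ℕ (Before y) := {}
  exact ⟨typein (Before y), fun a b => (typein_lt_typein _).symm, fun a o ho =>
    typein_surj _ (ho.trans (typein_lt_type _ a))⟩

theorem Enumerates.hasFirst {y : Cantor} {g : ℕ → Ordinal.{0}} (hg : Enumerates y g)
    (z : Cantor) : HasFirst y z := by
  intro hz
  obtain ⟨m, hm, H⟩ := (InvImage.wf g Ordinal.lt_wf).has_min {a | z a = true} hz
  exact ⟨m, hm, fun b hb hbm => H b hb ((hg.before_iff b m).1 hbm)⟩

namespace Program

variable {k : ℕ} (p : Program k) (x : Fin k → Cantor)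

/-- Every countable infinite part of a computation is coded by a real. -/
theorem exists_code {o : Ordinal.{0}} (h1 : ω ≤ o) (h2 : o < ω₁) :
    ∃ (y : Cantor) (g : ℕ → Ordinal.{0}), IsLinear y ∧ Enumerates y g ∧
      (∀ a, CodesConfig y a (p.run x (g a))) ∧ ∀ c < o, ∃ a, g a = c := by
  have hcard : o.card = Cardinal.aleph0 := by
    refine le_antisymm ?_ (by simpa using card_le_card h1)
    rw [← Cardinal.ord_aleph, Cardinal.lt_ord] at h2
    exact Cardinal.lt_aleph_one_iff.1 h2
  obtain ⟨e⟩ : Nonempty (ℕ ≃ Set.Iio o) := by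
    rw [← Cardinal.lift_mk_eq', Cardinal.mk_Iio_ordinal, hcard]
    simp
  let g : ℕ → Ordinal.{0} := fun a => e a
  have hinj : Function.Injective g := Subtype.val_injective.comp e.injective
  have hsurj : ∀ c < o, ∃ a, g a = c := fun c hc => ⟨e.symm ⟨c, hc⟩, by simp [g]⟩
  have hlt : ∀ a, g a < o := fun a => (e a).2
  obtain ⟨y, hy⟩ := exists_tripleCode fun c a b =>
    (c = 0 ∧ g a < g b) ∨ (c = 1 ∧ b = (p.run x (g a)).head) ∨
      (c = 2 ∧ b = (p.run x (g a)).state.code) ∨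
      ∃ t : Tape k, c = t.code ∧ (p.run x (g a)).cells t b = true
  have h3 : ∀ t : Tape k, 3 ≤ t.code := fun t => by cases t <;> simp [Tape.code]
  have hbefore : ∀ a b, Before y a b ↔ g a < g b := fun a b => by
    rw [Before, hy]
    grind
  refine ⟨y, g, ⟨fun a => ?_, fun a b c => ?_, fun a b => ?_⟩,
    ⟨hbefore, fun a c hc => hsurj c (hc.trans (hlt a))⟩, fun a => ⟨fun q => ?_, fun h => ?_,
      fun t i => ?_⟩, hsurj⟩
  · simp [hbefore]
  · simp only [hbefore]
    exact lt_trans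
  · simp only [hbefore, ← hinj.eq_iff (a := a)]
    exact lt_trichotomy _ _
  · rw [StateAt, hy, ← State.code_injective.eq_iff]
    grind
  · rw [HeadAt, hy]
    grind
  · rw [CellAt, hy]
    have := h3 t
    have : (∃ t' : Tape k, t.code = t'.code ∧ (p.run x (g a)).cells t' i = true) ↔
        (p.run x (g a)).cells t i = true := by
      simp [Tape.code_injective.eq_iff]
    rw [this]
    grind

end Program

/-! ### Coded computations that reach a loop -/

namespace Program

variable {k : ℕ} (p : Program k)

/-- The arithmetical condition that the computation coded by `y` contains a loop. -/
def HasLoop (y : Cantor) : Prop :=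
  ∃ a b, Before y a b ∧ StateAt y a (State.limit : State p.numAux) ∧
    StateAt y b (State.limit : State p.numAux) ∧ HeadAt y a 0 ∧ HeadAt y b 0 ∧
    (∀ (t : Tape k) i, CellAt y t a i ↔ CellAt y t b i) ∧
    ∀ (t : Tape k) i, ¬CellAt y t a i →
      ∀ d, ¬Before y d a → Before y d b → ¬CellAt y t d i

/-- The arithmetical condition that the computation coded by `y` reaches the halt state, with the
output consisting of the numbers `i` for which `R i` holds. -/
def HaltsWith (R : ℕ → Prop) (y : Cantor) : Prop :=
  ∃ a, StateAt y a (State.halt : State p.numAux) ∧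
    (∀ b, Before y b a → ¬StateAt y b (State.halt : State p.numAux)) ∧
    ∀ i, CellAt y (Tape.output : Tape k) a i ↔ R i

/-- The arithmetical part of the condition that `y` codes a part of the computation of `p` on input
`x` that is long enough to contain a loop. What is missing is that `Before y` is well-founded. -/
def IsPseudoRun (x : Fin k → Cantor) (y : Cantor) : Prop :=
  IsLinear y ∧ (∀ a, p.CoherentAt x y a) ∧ p.HasLoop y

variable {p} {x : Fin k → Cantor} {y : Cantor} {g : ℕ → Ordinal.{0}}

theorem hasLoop_iff (hg : Enumerates y g) (hc : ∀ a, CodesConfig y a (p.run x (g a))) :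
    p.HasLoop y ↔ ∃ a b, p.IsLoop x (g a) (g b) := by
  refine exists_congr fun a => exists_congr fun b => ?_
  simp only [hg.before_iff, (hc _).state, (hc _).head, (hc _).cells, not_lt, Bool.not_eq_true]
  constructor
  · rintro ⟨h1, h2, h3, h4, h5, h6, h7⟩
    refine ⟨h1, Config.eq_of_fields (h2.symm.trans h3) (h4.symm.trans h5)
      fun t i => Bool.eq_iff_iff.2 (h6 t i), h2.symm, h4.symm, fun t i h d hd1 hd2 => ?_⟩
    obtain ⟨d, rfl⟩ := hg.surj b d hd2
    exact h7 t i h d hd1 hd2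
  · rintro ⟨h1, h2, h3, h4, h5⟩
    exact ⟨h1, h3.symm, h2 ▸ h3.symm, h4.symm, h2 ▸ h4.symm, fun t i => by rw [h2],
      fun t i h d => h5 t i h (g d)⟩

/-- A computation that halts does so before the end of any loop, so that a coded computation with a
loop shows whether the machine halts, and with which output. -/
theorem IsPseudoRun.haltsWith_iff (h : p.IsPseudoRun x y) (hz : ∀ z, HasFirst y z)
    (R : ℕ → Prop) : p.HaltsWith R y ↔ ∃ w ∈ p.eval x, ∀ i, w i = true ↔ R i := by
  obtain ⟨hlin, hcoh, hloop⟩ := h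
  obtain ⟨g, hg⟩ := exists_enumerates hlin hz
  have hc := (forall_coherentAt_iff hg).1 hcoh
  simp only [HaltsWith, hg.before_iff, (hc _).state, (hc _).cells]
  constructor
  · rintro ⟨a, h1, h2, h3⟩
    have hmem : g a ∈ p.haltStages x := h1.symm
    have hinf : sInf (p.haltStages x) = g a := by
      refine le_antisymm (csInf_le' hmem) (le_csInf ⟨_, hmem⟩ fun o ho => not_lt.1 fun hlt => ?_)
      obtain ⟨b, rfl⟩ := hg.surj a o hlt
      exact h2 b hlt (Eq.symm ho)
    refine ⟨_, ⟨⟨_, hmem⟩, rfl⟩, fun i => ?_⟩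
    change (p.run x (sInf (p.haltStages x))).cells Tape.output i = true ↔ _
    rw [hinf, h3]
  · rintro ⟨_, ⟨hne, rfl⟩, hR⟩
    obtain ⟨a, b, hab⟩ := (hasLoop_iff hg hc).1 hloop
    -- Otherwise the loop would avoid the halt state, and the machine would never halt.
    have hlt : sInf (p.haltStages x) < g b := by
      by_contra hle
      refine hne.ne_empty (hab.haltStages_eq_empty fun d hd hdh => hle ?_)
      exact (csInf_le' (show d ∈ p.haltStages x from hdh)).trans_lt hd
    obtain ⟨c, hcs⟩ := hg.surj b _ hlt
    refine ⟨c, ?_, fun b hb hbh => ?_, fun i => ?_⟩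
    · rw [hcs]; exact (show sInf (p.haltStages x) ∈ p.haltStages x from csInf_mem hne).symm
    · rw [hcs] at hb
      exact notMem_of_lt_csInf' hb (show g b ∈ p.haltStages x from hbh.symm)
    · rw [hcs]; exact hR i

variable (p x) in
theorem exists_isPseudoRun : ∃ y, p.IsPseudoRun x y ∧ ∀ z, HasFirst y z := by
  obtain ⟨a, b, hb, hab⟩ := p.exists_isLoop_lt_omega_one x
  have hlim : IsSuccLimit (ω₁ : Ordinal.{0}) := Cardinal.isSuccLimit_omega 1
  -- The maximum with `ω` is taken because every number has to be the name of a stage.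
  obtain ⟨y, g, hlin, hg, hc, hsurj⟩ := p.exists_code x (o := max ω (b + 1)) (le_max_left _ _)
    (max_lt omega0_lt_omega_one (hlim.succ_lt hb))
  have hb' : b < max ω (b + 1) := lt_max_of_lt_right (lt_add_one b)
  obtain ⟨m, rfl⟩ := hsurj a (hab.lt.trans hb')
  obtain ⟨n, rfl⟩ := hsurj b hb'
  exact ⟨y, ⟨hlin, (forall_coherentAt_iff hg).2 hc, (hasLoop_iff hg hc).2 ⟨m, n, hab⟩⟩,
    hg.hasFirst⟩

end Program

/-! ### Arithmetical definability of the conditions on codes -/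

section Definability

variable {ι α : Type} {f g : (α → ℕ) → ℕ}

theorem IsTerm.tripleCode (c : ℕ) (hf : IsTerm ι f) (hg : IsTerm ι g) :
    IsTerm ι fun v => tripleCode c (f v) (g v) :=
  have h : IsTerm ι fun v => (c + ((f v + g v) * (f v + g v) + f v)) :=
    (IsTerm.const c).add (((hf.add hg).mul (hf.add hg)).add hf)
  (h.mul h).add (IsTerm.const c)

namespace IsArith

theorem before (i : ι) (hf : IsTerm ι f) (hg : IsTerm ι g) :
    IsArith fun (X : ι → Cantor) v => Before (X i) (f v) (g v) :=
  mem i (hf.tripleCode 0 hg)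

theorem headAt (i : ι) (hf : IsTerm ι f) (hg : IsTerm ι g) :
    IsArith fun (X : ι → Cantor) v => HeadAt (X i) (f v) (g v) :=
  mem i (hf.tripleCode 1 hg)

theorem stateAt {n : ℕ} (i : ι) (hf : IsTerm ι f) (q : State n) :
    IsArith fun (X : ι → Cantor) v => StateAt (X i) (f v) q :=
  mem i (hf.tripleCode 2 (IsTerm.const q.code))

theorem cellAt {k : ℕ} (i : ι) (t : Tape k) (hf : IsTerm ι f) (hg : IsTerm ι g) :
    IsArith fun (X : ι → Cantor) v => CellAt (X i) t (f v) (g v) :=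
  mem i (hf.tripleCode t.code hg)

theorem eq_moveHead (d : Dir) (hf : IsTerm ι f) (hg : IsTerm ι g) :
    IsArith fun (_ : ι → Cantor) v => f v = Program.moveHead d (g v) := by
  cases d with
  | right => exact eq hf (hg.add IsTerm.one)
  | left =>
    refine IsArith.congr (P := fun _ v => f v + 1 = g v ∨ (g v = 0 ∧ f v = 0))
      ((eq (hf.add IsTerm.one) hg).or ((eq hg IsTerm.zero).and (eq hf IsTerm.zero)))
      fun _ v => ?_
    simp only [Program.moveHead]
    omega

variable {k : ℕ} (p : Program k) (r : Fin k → ι) (i j : ι)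

theorem initAt (a : α) :
    IsArith fun (X : ι → Cantor) v => p.InitAt (fun j => X (r j)) (X i) (v a) :=
  .and (.finAll fun q => .iff (.stateAt i (.var _) q) (.const _)) <|
  .and (.all (.iff (.headAt i (.var _) (.var _)) (.eq (.var _) .zero))) <|
  .and (.finAll fun j => .all (.iff (.cellAt i _ (.var _) (.var _)) (.mem (r j) (.var _)))) <|
  .and (.all (.not (.cellAt i _ (.var _) (.var _))))
    (.all (.not (.cellAt i _ (.var _) (.var _))))

theorem stepAt (b a : α) : IsArith fun (X : ι → Cantor) v => p.StepAt (X i) (v b) (v a) :=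
  .finAll fun q => .finAll fun _ => .imp (.stateAt i (.var _) q) <| .all <|
  .imp (.headAt i (.var _) (.var _)) <|
  .imp (.finAll fun t => .iff (.cellAt i t (.var _) (.var _)) (.const _)) <|
  .and (.finAll fun q' => .iff (.stateAt i (.var _) q') (.const _)) <|
  .and (.all (.iff (.headAt i (.var _) (.var _)) (.eq_moveHead _ (.var _) (.var _)))) <|
  .finAll fun t => .all <| .iff (.cellAt i t (.var _) (.var _)) <|
  .or (.and (.eq (.var _) (.var _)) (.const _))
    (.and (.not (.eq (.var _) (.var _))) (.cellAt i t (.var _) (.var _)))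

theorem limitAt (a : α) : IsArith fun (X : ι → Cantor) v => p.LimitAt (X i) (v a) :=
  .and (.finAll fun q => .iff (.stateAt i (.var _) q) (.const _)) <|
  .and (.all (.iff (.headAt i (.var _) (.var _)) (.eq (.var _) .zero))) <|
  .finAll fun t => .all <| .iff (.cellAt i t (.var _) (.var _)) <| .not <| .ex <|
  .and (.before i (.var _) (.var _)) <| .all <| .imp (.not (.before i (.var _) (.var _))) <|
  .imp (.before i (.var _) (.var _)) (.not (.cellAt i t (.var _) (.var _)))

theorem coherentAt (a : α) :
    IsArith fun (X : ι → Cantor) v => p.CoherentAt (fun j => X (r j)) (X i) (v a) :=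
  .and (.imp (.all (.not (.before i (.var _) (.var _)))) (.initAt p r i a)) <|
  .and (.all <| .imp (.before i (.var _) (.var _)) <|
    .imp (.all (.imp (.before i (.var _) (.var _)) (.not (.before i (.var _) (.var _)))))
      (.stepAt p i _ _)) <|
  .imp (.ex (.before i (.var _) (.var _))) <|
  .imp (.all (.imp (.before i (.var _) (.var _))
    (.ex (.and (.before i (.var _) (.var _)) (.before i (.var _) (.var _))))))
    (.limitAt p i a)

theorem isLinear : IsArith fun (X : ι → Cantor) (_ : α → ℕ) => IsLinear (X i) :=
  .and (.all (.not (.before i (.var _) (.var _)))) <|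
  .and (.all <| .all <| .all <| .imp (.before i (.var _) (.var _)) <|
    .imp (.before i (.var _) (.var _)) (.before i (.var _) (.var _))) <|
  .all <| .all <| .or (.before i (.var _) (.var _)) <| .or (.eq (.var _) (.var _))
    (.before i (.var _) (.var _))

theorem hasFirst : IsArith fun (X : ι → Cantor) (_ : α → ℕ) => HasFirst (X i) (X j) :=
  .imp (.ex (.mem j (.var _))) <| .ex <| .and (.mem j (.var _)) <| .all <|
  .imp (.mem j (.var _)) (.not (.before i (.var _) (.var _)))

theorem hasLoop : IsArith fun (X : ι → Cantor) (_ : α → ℕ) => p.HasLoop (X i) :=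
  .ex <| .ex <| .and (.before i (.var _) (.var _)) <|
  .and (.stateAt i (.var _) _) <| .and (.stateAt i (.var _) _) <|
  .and (.headAt i (.var _) .zero) <| .and (.headAt i (.var _) .zero) <|
  .and (.finAll fun t => .all <| .iff (.cellAt i t (.var _) (.var _))
    (.cellAt i t (.var _) (.var _))) <|
  .finAll fun t => .all <| .imp (.not (.cellAt i t (.var _) (.var _))) <| .all <|
  .imp (.not (.before i (.var _) (.var _))) <| .imp (.before i (.var _) (.var _))
    (.not (.cellAt i t (.var _) (.var _)))

theorem isPseudoRun :
    IsArith fun (X : ι → Cantor) (_ : α → ℕ) => p.IsPseudoRun (fun j => X (r j)) (X i) :=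
  .and (.isLinear i) (.and (.all (.coherentAt p r i _)) (.hasLoop p i))

theorem haltsWith {R : (ι → Cantor) → ℕ → Prop}
    (hR : ∀ {β : Type} (b : β), IsArith fun (X : ι → Cantor) v => R X (v b)) :
    IsArith fun (X : ι → Cantor) (_ : α → ℕ) => p.HaltsWith (R X) (X i) :=
  .ex <| .and (.stateAt i (.var _) _) <|
  .and (.all (.imp (.before i (.var _) (.var _)) (.not (.stateAt i (.var _) _)))) <|
  .all (.iff (.cellAt i _ (.var _) (.var _)) (hR _))

end IsArith

end Definability

/-! ### The complexity of graphs and of semi-decidable sets -/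

/-- The inputs on which `p` halts with an output that has an arithmetical definition form a `Δ¹₂`
set. The output may depend on reals other than the inputs: those of the tuple `x` that are not
selected by `r`. -/
theorem Program.isDelta12_eval {k m : ℕ} (p : Program k) (r : Fin k → Fin m)
    {R : (Fin m → Cantor) → ℕ → Prop}
    (hR : ∀ {β : Type} (b : β),
      IsArith fun (X : Fin m ⊕ Fin 2 → Cantor) v => R (fun j => X (Sum.inl j)) (v b)) :
    IsDelta12 {x : Fin m → Cantor |
      ∃ w ∈ p.eval fun j => x (r j), ∀ i, w i = true ↔ R x i} := by
  have hrun : IsArith fun (X : Fin m ⊕ Fin 2 → Cantor) (_ : Empty → ℕ) =>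
      p.IsPseudoRun (fun j => X (Sum.inl (r j))) (X (Sum.inr 0)) :=
    .isPseudoRun p (fun j => Sum.inl (r j)) (Sum.inr 0)
  have hfirst : IsArith fun (X : Fin m ⊕ Fin 2 → Cantor) (_ : Empty → ℕ) =>
      HasFirst (X (Sum.inr 0)) (X (Sum.inr 1)) := .hasFirst _ _
  have hhalt : IsArith fun (X : Fin m ⊕ Fin 2 → Cantor) (_ : Empty → ℕ) =>
      p.HaltsWith (R fun j => X (Sum.inl j)) (X (Sum.inr 0)) :=
    .haltsWith p (R := fun X => R fun j => X (Sum.inl j)) _ hR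
  constructor
  · obtain ⟨φ, hφ⟩ := ((hrun.and hhalt).and hfirst).exists_sentence
    refine ⟨φ, fun x => ?_⟩
    simp only [hφ]
    constructor
    · intro hx
      obtain ⟨y, hy, hz⟩ := p.exists_isPseudoRun fun j => x (r j)
      exact ⟨y, fun z => ⟨⟨hy, (hy.haltsWith_iff hz (R x)).2 hx⟩, hz z⟩⟩
    · rintro ⟨y, hy⟩
      have hrun : p.IsPseudoRun (fun j => x (r j)) y := (hy y).1.1
      exact (hrun.haltsWith_iff (fun z => (hy z).2) (R x)).1 (hy y).1.2
  · obtain ⟨φ, hφ⟩ := ((hrun.and hfirst).imp hhalt).exists_sentence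
    refine ⟨φ, fun x => ?_⟩
    simp only [hφ]
    constructor
    · intro hx y
      by_cases hy : p.IsPseudoRun (fun j => x (r j)) y ∧ ∀ z, HasFirst y z
      · exact ⟨y, fun _ => (hy.1.haltsWith_iff hy.2 (R x)).2 hx⟩
      · rw [not_and_or, not_forall] at hy
        obtain hy | ⟨z, hz⟩ := hy
        · exact ⟨y, fun h => absurd h.1 hy⟩
        · exact ⟨z, fun h => absurd h.2 hz⟩
    · intro H
      obtain ⟨y, hy, hz⟩ := p.exists_isPseudoRun fun j => x (r j)
      obtain ⟨z, h⟩ := H y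
      exact (hy.haltsWith_iff hz (R x)).1 (h ⟨hy, hz z⟩)

theorem Computable.isDelta12_graph {k : ℕ} {f : (Fin k → Cantor) →. Cantor}
    (hf : Computable f) : IsDelta12 (graph f) := by
  obtain ⟨p, rfl⟩ := hf
  convert p.isDelta12_eval (m := k + 1) Fin.castSucc
    (R := fun x i => x (Fin.last k) i = true) fun b => .mem (Sum.inl (Fin.last k)) (.var b) using 1
  ext x
  constructor
  · exact fun h => ⟨_, h, fun _ => Iff.rfl⟩
  · rintro ⟨w, hw, h⟩
    obtain rfl : w = x (Fin.last k) := funext fun i => Bool.eq_iff_iff.2 (h i)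
    exact hw

theorem Computable.isDelta12_setOf_oneReal_mem {k : ℕ} {f : (Fin k → Cantor) →. Cantor}
    (hf : Computable f) : IsDelta12 {x | oneReal ∈ f x} := by
  obtain ⟨p, rfl⟩ := hf
  convert p.isDelta12_eval id (R := fun _ i => i = 0) fun b => .eq (.var b) .zero using 1
  ext x
  constructor
  · exact fun h => ⟨_, h, fun _ => by simp [oneReal]⟩
  · rintro ⟨w, hw, h⟩
    obtain rfl : w = oneReal := funext fun i => Bool.eq_iff_iff.2 (by simp [oneReal, h])
    exact hw

theorem SemiDecidable.isDelta12 {k : ℕ} {A : Set (Fin k → Cantor)} (hA : SemiDecidable A) :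
    IsDelta12 A := by
  convert Computable.isDelta12_setOf_oneReal_mem hA using 1
  ext x
  exact ⟨fun h => ⟨h, rfl⟩, fun ⟨h, _⟩ => h⟩

theorem Decidable.isDelta12 {k : ℕ} {A : Set (Fin k → Cantor)} (hA : Decidable A) :
    IsDelta12 A := by
  convert Computable.isDelta12_setOf_oneReal_mem hA using 1
  ext x
  by_cases h : x ∈ A
  · simp [h]
  · have : oneReal ≠ zeroReal := fun h => by simpa [oneReal, zeroReal] using congrFun h 0
    simp [h, this]

end ITTM

theorem mainTheorem3 :
    (∀ (k : ℕ) (f : (Fin k → ITTM.Cantor) →. ITTM.Cantor),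
      ITTM.Computable f → ITTM.IsDelta12 (ITTM.graph f)) ∧
    (∀ (k : ℕ) (A : Set (Fin k → ITTM.Cantor)), ITTM.Decidable A → ITTM.IsDelta12 A) ∧
    (∀ (k : ℕ) (A : Set (Fin k → ITTM.Cantor)), ITTM.SemiDecidable A → ITTM.IsDelta12 A) :=
  ⟨fun _ _ h => h.isDelta12_graph, fun _ _ h => h.isDelta12, fun _ _ h => h.isDelta12⟩
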